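/- Let $Q(z,z)=(|z-1|^2-2)(|z+1|^2-2)$ for $z\in\mathbb C$. For $0\le t\le 1$ let $\Omega(t)=\{z\in\mathbb C: Q(z,z)<t\}$, and let the hole of $\Omega(t)$ be the union of the bounded connected components of $\mathbb C\setminus\overline{\Omega(t)}$ (for $t=0$ it is the open intersection of the two disks $|z\mp1|<\sqrt2$; for $t=1$ it is empty). Let $g_t$ be equal to $1$ on $\Omega(t)$, to $2$ on the hole, and to $0$ elsewhere, and let $\operatorname{supp} g_t$ be the closure of $\{z: g_t(z)\neq 0\}$. Then for every $0\le t\le 1$ and every complex-valued function $h$ that is harmonic in a neighbourhood of $\operatorname{supp} g_t$, the function $h\,g_t$ is integrable over $\mathbb C$ with respect to the area measure $dA=dx\,dy$, and $$\int_{\mathbb C} h\,g_t\,dA = 2\pi\,\bigl(h(-1)+h(1)\bigr).$$ -/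

import Mathlib

open MeasureTheory InnerProductSpace

noncomputable section

namespace LevelLine

/-- The real polynomial `Q(z,z) = (|z-1|² - 2)(|z+1|² - 2)`, whose zero set is the union of the
circles of radius `√2` about `1` and `-1`. -/
def Q (z : ℂ) : ℝ := (‖z - 1‖ ^ 2 - 2) * (‖z + 1‖ ^ 2 - 2)

/-- The sub-level set `Ω(t) = {z : Q(z,z) < t}`. -/
def Omega (t : ℝ) : Set ℂ := {z | Q z < t}

/-- The (open) hole of `Ω(t)`: the union of the bounded connected components of the complement of
the closure of `Ω(t)`. Taking the closure matters only for the endpoints. For `t = 0` the closed lens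
and the closed exterior of the two disks touch at `±i`, so that `ℂ \ Ω(0)` has no bounded component,
while the hole is the open lens. For `t = 1` the isolated point `0` of `ℂ \ Ω(1)` is
ignored and the hole is empty. For `0 < t < 1` only the boundary curve, a null set, is left out. -/
def hole (t : ℝ) : Set ℂ :=
  {z | z ∈ (closure (Omega t))ᶜ ∧
    Bornology.IsBounded (connectedComponentIn (closure (Omega t))ᶜ z)}

open Classical in
/-- The density `g_t`: one in `Ω(t)`, two in the hole, zero elsewhere. -/
def g (t : ℝ) (z : ℂ) : ℝ := if z ∈ Omega t then 1 else if z ∈ hole t then 2 else 0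

end LevelLine

end

/-! Off the null set `Q = t`, the density `g t` is the sum of the indicators of two regions,
`outerRegion t` and `innerRegion t`. In polar coordinates these are `r² < ρ₊(θ)` and `r² < ρ₋(θ)`,
where `ρ₊` and `ρ₋` are the roots of `X² - 2(2 + cos 2θ)X + (1 - t)`.

Odd moments vanish by the symmetry `z ↦ -z`. The moment of order `2m` is `1/(2m+2)` times the
integral of `exp(2imθ)(ρ₊^(m+1) + ρ₋^(m+1))`. By Newton's recurrence the power sum is a
trigonometric polynomial in `2θ` of degree `m + 1`. The product of the roots, which alone involves
`t`, enters two degrees below the top, so the coefficient needed, one below the top, is independent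
of `t` (`powerSumCoeff_values`). Hence the moments are those of point masses `2π` at `-1` and `1`.

The closure of the outer region is star-shaped about `0`. Dilating a test function and applying the
identity theorem in the dilation parameter carries equality of moments over to analytic functions.
Integrating the gradient along rays then gives harmonic ones. -/

/-! ### From moments to harmonic test functions on a star-shaped compact set. -/

open Set Metric Filter Topology in
/-- If `F` is analytic near a compact set `K` that is star-shaped about the origin, the integral of
`z ↦ F (c * z)` depends analytically on `c` near `[0, 1]`. -/
theorem exists_differentiableOn_integral_dilation {K : Set ℂ} (hK : IsCompact K)
    (hstar : ∀ s ∈ Icc (0 : ℝ) 1, ∀ z ∈ K, (s : ℂ) * z ∈ K) {F : ℂ → ℂ}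
    (hF : AnalyticOnNhd ℂ F K) :
    ∃ V : Set ℂ, IsOpen V ∧ IsPreconnected V ∧ 0 ∈ V ∧ 1 ∈ V ∧
      ∀ (μ : Measure ℂ) [IsFiniteMeasure μ],
        DifferentiableOn ℂ (fun c => ∫ z in K, F (c * z) ∂μ) V := by
  set U : Set ℂ := {z | AnalyticAt ℂ F z} with hU
  have hUo : IsOpen U := isOpen_analyticAt ℂ F
  set S : Set ℂ := (fun s : ℝ => (s : ℂ)) '' Icc (0 : ℝ) 1 with hS
  have hSc : IsCompact S := isCompact_Icc.image Complex.continuous_ofReal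
  have hSconv : Convex ℝ S := by
    have := (convex_Icc (0 : ℝ) 1).is_linear_image (f := fun s : ℝ => (s : ℂ))
      Complex.ofRealCLM.isLinear
    exact this
  have hmul : Continuous (fun p : ℂ × ℂ => p.1 * p.2) := continuous_mul
  have hsub : S ×ˢ K ⊆ (fun p : ℂ × ℂ => p.1 * p.2) ⁻¹' U := by
    rintro ⟨c, z⟩ ⟨⟨s, hs, rfl⟩, hz⟩
    exact hF _ (hstar s hs z hz)
  -- Compactness of `S` and `K` gives a uniform margin: a whole thickening of the segment `S` still
  -- dilates `K` into the domain of analyticity. A thickening of a convex set is convex, hence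
  -- connected.
  obtain ⟨A, B, hA, -, hSA, hKB, hAB⟩ :=
    generalized_tube_lemma hSc hK (hUo.preimage hmul) hsub
  obtain ⟨δ, hδ, hδA⟩ := hSc.exists_cthickening_subset_open hA hSA
  have hWc : IsCompact (cthickening δ S) := hSc.cthickening
  have hmem : ∀ c ∈ cthickening δ S, ∀ z ∈ K, c * z ∈ U := fun c hc z hz =>
    hAB (mk_mem_prod (hδA hc) (hKB hz))
  have hVW : thickening δ S ⊆ cthickening δ S := thickening_subset_cthickening _ _
  refine ⟨thickening δ S, isOpen_thickening, (hSconv.thickening δ).isPreconnected,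
    self_subset_thickening hδ _ ⟨0, by simp, by simp⟩,
    self_subset_thickening hδ _ ⟨1, by simp, by simp⟩, ?_⟩
  intro μ _
  have hcont : ∀ G : ℂ → ℂ, ContinuousOn G U → ∀ c ∈ cthickening δ S,
      ContinuousOn (fun z => G (c * z)) K := fun G hG c hc =>
    hG.comp (by fun_prop) (fun z hz => hmem c hc z hz)
  have hFU : ContinuousOn F U := fun z hz => (AnalyticAt.continuousAt hz).continuousWithinAt
  have hF'U : ContinuousOn (deriv F) U := fun z hz =>
    (AnalyticAt.deriv hz).continuousAt.continuousWithinAt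
  have hbc : ContinuousOn (fun p : ℂ × ℂ => p.2 * deriv F (p.1 * p.2)) (cthickening δ S ×ˢ K) :=
    continuousOn_snd.mul (hF'U.comp hmul.continuousOn fun p hp => hmem p.1 hp.1 p.2 hp.2)
  obtain ⟨C, hC⟩ := (hWc.prod hK).exists_bound_of_continuousOn hbc
  intro c hc
  have := hasDerivAt_integral_of_dominated_loc_of_deriv_le (μ := μ.restrict K) (𝕜 := ℂ)
    (F := fun c z => F (c * z)) (F' := fun c z => z * deriv F (c * z)) (x₀ := c)
    (bound := fun _ => C) (isOpen_thickening.mem_nhds hc) ?_ ?_ ?_ ?_ ?_ ?_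
  · exact this.2.differentiableAt.differentiableWithinAt
  · filter_upwards [isOpen_thickening.mem_nhds hc] with c' hc'
    exact (hcont F hFU c' (hVW hc')).aestronglyMeasurable_of_isCompact hK hK.measurableSet
  · exact (hcont F hFU c (hVW hc)).integrableOn_compact hK
  · exact (continuousOn_id.mul (hcont _ hF'U c (hVW hc))).aestronglyMeasurable_of_isCompact hK
      hK.measurableSet
  · filter_upwards [ae_restrict_mem hK.measurableSet] with z hz c' hc'
    exact hC (c', z) ⟨hVW hc', hz⟩
  · exact integrable_const _
  · filter_upwards [ae_restrict_mem hK.measurableSet] with z hz c' hc'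
    have h1 := (AnalyticAt.differentiableAt (hmem c' (hVW hc') z hz)).hasDerivAt
    have h2 : HasDerivAt (fun c : ℂ => c * z) z c' := by
      simpa using (hasDerivAt_id c').mul_const z
    simpa [mul_comm, Function.comp_def] using! h1.comp c' h2

open Set Metric Filter Topology in
/-- For small `c` the integral of `z ↦ F (c * z)` is determined by the moments of the measure. -/
theorem eventually_hasSum_integral_dilation {K : Set ℂ} (hK : IsCompact K) {F : ℂ → ℂ}
    (hF : AnalyticAt ℂ F 0) :
    ∃ a : ℕ → ℂ, ∀ᶠ c in 𝓝 (0 : ℂ), ∀ (μ : Measure ℂ) [IsFiniteMeasure μ],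
      HasSum (fun n => a n * c ^ n * ∫ z in K, z ^ n ∂μ) (∫ z in K, F (c * z) ∂μ) := by
  obtain ⟨p, r, hp⟩ := hF
  obtain ⟨R, hR0, hR⟩ := hK.isBounded.exists_pos_norm_le
  refine ⟨fun n => p.coeff n, ?_⟩
  have hlim : Tendsto (fun c : ℂ => ENNReal.ofReal (‖c‖ * R)) (𝓝 0) (𝓝 0) := by
    have : Continuous (fun c : ℂ => ENNReal.ofReal (‖c‖ * R)) :=
      ENNReal.continuous_ofReal.comp (by fun_prop)
    simpa using this.tendsto 0
  filter_upwards [hlim.eventually (gt_mem_nhds hp.r_pos)] with c hc μ _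
  have hsum : Summable fun n => ‖p n‖ * (‖c‖ * R) ^ n := by
    have := p.summable_norm_mul_pow (r := (‖c‖ * R).toNNReal) (lt_of_lt_of_le hc hp.r_le)
    simpa [Real.coe_toNNReal _ (by positivity : 0 ≤ ‖c‖ * R)] using this
  have hpt : ∀ z ∈ K, HasSum (fun n => p.coeff n * c ^ n * z ^ n) (F (c * z)) := by
    intro z hz
    have hin : c * z ∈ eball (0 : ℂ) r := by
      rw [mem_eball_zero_iff]
      refine lt_of_le_of_lt ?_ hc
      rw [← ofReal_norm, norm_mul]
      exact ENNReal.ofReal_le_ofReal (mul_le_mul_of_nonneg_left (hR z hz) (norm_nonneg _))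
    have := hp.hasSum hin
    simpa [mul_pow, mul_comm, mul_left_comm, mul_assoc] using this
  have := hasSum_integral_of_dominated_convergence (μ := μ.restrict K)
    (F := fun n z => p.coeff n * c ^ n * z ^ n) (f := fun z => F (c * z))
    (fun n _ => ‖p n‖ * (‖c‖ * R) ^ n) ?_ ?_ ?_ ?_ ?_
  · simpa only [integral_const_mul] using this
  · intro n
    exact (by fun_prop : Continuous fun z : ℂ => p.coeff n * c ^ n * z ^ n).aestronglyMeasurable
  · intro n
    filter_upwards [ae_restrict_mem hK.measurableSet] with z hz
    have h1 := hR z hz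
    rw [norm_mul, norm_mul, norm_pow, norm_pow, mul_assoc, ← mul_pow, p.norm_apply_eq_norm_coef]
    gcongr
  · exact ae_of_all _ fun _ => hsum
  · exact integrable_const _
  · filter_upwards [ae_restrict_mem hK.measurableSet] with z hz using hpt z hz

open Set Metric Filter Topology in
/-- Two finite measures with the same moments on a compact set that is star-shaped about the origin
give the same integral to every function analytic near this set. -/
theorem setIntegral_eq_of_moments_of_analyticOnNhd {K : Set ℂ} (hK : IsCompact K) (h0 : 0 ∈ K)
    (hstar : ∀ s ∈ Icc (0 : ℝ) 1, ∀ z ∈ K, (s : ℂ) * z ∈ K) {μ ν : Measure ℂ} [IsFiniteMeasure μ]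
    [IsFiniteMeasure ν] (hm : ∀ n : ℕ, ∫ z in K, z ^ n ∂μ = ∫ z in K, z ^ n ∂ν) {F : ℂ → ℂ}
    (hF : AnalyticOnNhd ℂ F K) : ∫ z in K, F z ∂μ = ∫ z in K, F z ∂ν := by
  obtain ⟨V, hVo, hVc, hV0, hV1, hV⟩ := exists_differentiableOn_integral_dilation hK hstar hF
  obtain ⟨a, ha⟩ := eventually_hasSum_integral_dilation hK (hF 0 h0)
  -- The coefficients `a` do not depend on the measure, so equal moments make the two functions of
  -- `c` agree near `0`, hence at `c = 1`.
  have key := ((hV μ).analyticOnNhd hVo).eqOn_of_preconnected_of_eventuallyEq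
    ((hV ν).analyticOnNhd hVo) hVc hV0 (by
      filter_upwards [ha] with c hc
      have h1 := hc μ
      simp only [hm] at h1
      exact h1.unique (hc ν))
  simpa using key hV1

open Set Metric Filter Topology in
/-- Two finite measures with the same moments on a compact set that is star-shaped about the origin
give the same integral to every function harmonic near this set. -/
theorem setIntegral_eq_of_moments_of_harmonicOnNhd {K : Set ℂ} (hK : IsCompact K) (h0 : 0 ∈ K)
    (hstar : ∀ s ∈ Icc (0 : ℝ) 1, ∀ z ∈ K, (s : ℂ) * z ∈ K) {μ ν : Measure ℂ} [IsFiniteMeasure μ]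
    [IsFiniteMeasure ν] (hm : ∀ n : ℕ, ∫ z in K, z ^ n ∂μ = ∫ z in K, z ^ n ∂ν) {u : ℂ → ℝ}
    (hu : HarmonicOnNhd u K) : ∫ z in K, u z ∂μ = ∫ z in K, u z ∂ν := by
  set φ : ℂ → ℂ := fun z => fderiv ℝ u z 1 - Complex.I * fderiv ℝ u z Complex.I with hφ
  have hφK : AnalyticOnNhd ℂ φ K := fun z hz => HarmonicAt.analyticAt_complex_partial (hu z hz)
  have hφre : ∀ w z : ℂ, fderiv ℝ u w z = (z * φ w).re := by
    intro w z
    have : z = z.re • (1 : ℂ) + z.im • Complex.I := by simp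
    conv_lhs => rw [this, map_add, map_smul, map_smul]
    simp [hφ]
  have hc2 : ContinuousOn (fun p : ℂ × ℝ => p.1 * φ (p.2 * p.1)) (K ×ˢ Icc (0 : ℝ) 1) :=
    continuousOn_fst.mul (hφK.continuousOn.comp (by fun_prop)
      fun p hp => hstar p.2 hp.2 p.1 hp.1)
  -- The radial integral of the analytic function `φ = u_x - i u_y` avoids constructing a harmonic
  -- conjugate near `K`.
  have hftc : ∀ z ∈ K, u z = u 0 + ∫ s in (0 : ℝ)..1, (z * φ (s * z)).re := by
    intro z hz
    rw [intervalIntegral.integral_eq_sub_of_hasDerivAt (f := fun s : ℝ => u (s * z))]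
    · simp
    · intro s hs
      rw [uIcc_of_le zero_le_one] at hs
      have h1 := ((hu _ (hstar s hs z hz)).1.differentiableAt two_ne_zero).hasFDerivAt
      have h2 : HasDerivAt (fun s : ℝ => (s : ℂ) * z) z s := by
        simpa using (Complex.ofRealCLM.hasDerivAt (x := s)).mul_const z
      have := h1.comp_hasDerivAt s h2
      rw [hφre] at this
      exact this
    · apply ContinuousOn.intervalIntegrable
      rw [uIcc_of_le zero_le_one]
      refine Complex.continuous_re.comp_continuousOn (hc2.comp (f := fun s : ℝ => (z, s))
        (by fun_prop) fun s hs => ⟨hz, hs⟩)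
  have hrep : ∀ (ρ : Measure ℂ) [IsFiniteMeasure ρ], ∫ z in K, u z ∂ρ =
      u 0 * ρ.real K + ∫ s in (0 : ℝ)..1, (∫ z in K, z * φ (s * z) ∂ρ).re := by
    intro ρ _
    have hint : IntegrableOn (fun p : ℂ × ℝ => (p.1 * φ (p.2 * p.1)).re) (K ×ˢ Icc (0 : ℝ) 1)
        (ρ.prod volume) :=
      (Complex.continuous_re.comp_continuousOn hc2).integrableOn_compact (hK.prod isCompact_Icc)
    have hint' : Integrable (fun p : ℂ × ℝ => (p.1 * φ (p.2 * p.1)).re)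
        ((ρ.restrict K).prod (volume.restrict (Ioc (0 : ℝ) 1))) := by
      rw [Measure.prod_restrict]
      exact hint.mono_set (prod_mono_right Ioc_subset_Icc_self)
    rw [setIntegral_congr_fun hK.measurableSet hftc, integral_add (integrable_const _)]
    · congr 1
      · simp [mul_comm]
      · simp only [intervalIntegral.integral_of_le zero_le_one]
        rw [integral_integral_swap hint']
        refine setIntegral_congr_fun measurableSet_Ioc fun s hs => ?_
        have hs' := Ioc_subset_Icc_self hs
        have hci : ContinuousOn (fun z => z * φ (s * z)) K :=
          hc2.comp (f := fun z : ℂ => (z, s)) (by fun_prop) fun z hz => ⟨hz, hs'⟩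
        exact integral_re (hci.integrableOn_compact hK)
    · simp only [intervalIntegral.integral_of_le zero_le_one]
      exact hint'.integral_prod_left
  have hmass : μ.real K = ν.real K := by
    have := hm 0
    simpa using this
  rw [hrep μ, hrep ν, hmass]
  congr 1
  refine intervalIntegral.integral_congr fun s hs => ?_
  rw [uIcc_of_le zero_le_one] at hs
  have := setIntegral_eq_of_moments_of_analyticOnNhd hK h0 hstar hm
    (F := fun z => z * φ (s * z)) fun z hz =>
      analyticAt_id.mul ((hφK _ (hstar s hs z hz)).fun_comp (analyticAt_const.mul analyticAt_id))
  exact congrArg Complex.re this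

/-! ### The geometry of `Ω(t)`, its hole and the two regions. -/

namespace LevelLine

/-- The region enclosed by the outer boundary curve of `Ω(t)`. -/
def outerRegion (t : ℝ) : Set ℂ := {z | ‖z‖ ^ 4 < 1 - t ∨ Q z < t}

/-- The region enclosed by the inner boundary curve of `Ω(t)`. -/
def innerRegion (t : ℝ) : Set ℂ := {z | ‖z‖ ^ 4 < 1 - t ∧ t < Q z}

theorem norm_sq_eq (z : ℂ) : ‖z‖ ^ 2 = z.re ^ 2 + z.im ^ 2 := by
  rw [Complex.sq_norm, Complex.normSq_apply]; ring

theorem norm_pow_four_eq (z : ℂ) : ‖z‖ ^ 4 = (z.re ^ 2 + z.im ^ 2) ^ 2 := by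
  rw [← norm_sq_eq]; ring

theorem Q_eq (z : ℂ) :
    Q z = (z.re ^ 2 + z.im ^ 2) ^ 2 - 2 * (3 * z.re ^ 2 + z.im ^ 2) + 1 := by
  simp only [Q, norm_sq_eq, Complex.sub_re, Complex.sub_im, Complex.add_re, Complex.add_im,
    Complex.one_re, Complex.one_im]
  ring

theorem continuous_Q : Continuous Q := by
  unfold Q; fun_prop

theorem isOpen_Omega (t : ℝ) : IsOpen (Omega t) := isOpen_lt continuous_Q continuous_const

theorem isOpen_outerRegion (t : ℝ) : IsOpen (outerRegion t) :=
  (isOpen_lt (continuous_norm.pow 4) continuous_const : IsOpen {z : ℂ | ‖z‖ ^ 4 < 1 - t}).union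
    (isOpen_Omega t)

theorem isOpen_innerRegion (t : ℝ) : IsOpen (innerRegion t) :=
  (isOpen_lt (continuous_norm.pow 4) continuous_const : IsOpen {z : ℂ | ‖z‖ ^ 4 < 1 - t}).inter
    (isOpen_lt continuous_const continuous_Q)

theorem closure_Omega_subset (t : ℝ) : closure (Omega t) ⊆ {z | Q z ≤ t} :=
  closure_minimal (fun z (hz : Q z < t) => hz.le) (isClosed_le continuous_Q continuous_const)

/-- With `N = ‖z‖² ≤ 1` and `N² = 1 - t`, one has `Q z - t = 2(N² - N) - 4 (re z)² ≤ 0`. Equality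
forces `re z = 0`, and there a small horizontal shift makes `Q` drop below `t`. -/
theorem mem_closure_Omega_of_norm_pow_four_eq {t : ℝ} (ht : 0 ≤ t) {z : ℂ}
    (hz : ‖z‖ ^ 4 = 1 - t) : z ∈ closure (Omega t) := by
  rw [Metric.mem_closure_iff]
  intro ε hε
  by_cases hQ : Q z < t
  · exact ⟨z, hQ, by simpa using hε⟩
  have hd : 0 < min 1 (ε / 2) := by positivity
  set d := min 1 (ε / 2) with hdef
  have hd1 : d ≤ 1 := min_le_left _ _
  have hd2 : d ≤ ε / 2 := min_le_right _ _
  refine ⟨z + (d : ℂ), ?_, ?_⟩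
  · rw [norm_pow_four_eq] at hz
    rw [Q_eq] at hQ
    change Q _ < t
    rw [Q_eq]
    simp only [Complex.add_re, Complex.add_im, Complex.ofReal_re, Complex.ofReal_im, add_zero]
    push Not at hQ
    have hN1 : z.re ^ 2 + z.im ^ 2 ≤ 1 := by
      nlinarith [sq_nonneg z.re, sq_nonneg z.im]
    have hN2 : (z.re ^ 2 + z.im ^ 2) ^ 2 ≤ z.re ^ 2 + z.im ^ 2 := by
      nlinarith [sq_nonneg z.re, sq_nonneg z.im]
    have hx : z.re = 0 := by
      have : z.re ^ 2 = 0 := le_antisymm (by nlinarith) (sq_nonneg _)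
      simpa using this
    rw [hx] at hz hN1 hN2 hQ ⊢
    have hdd : 0 < d ^ 2 := by positivity
    have hdd1 : d ^ 2 ≤ 1 := by nlinarith
    nlinarith [mul_nonneg hdd.le (sub_nonneg.2 hN1), mul_nonneg hdd.le (sub_nonneg.2 hdd1)]
  · rw [dist_eq_norm]
    simp only [sub_add_cancel_left, norm_neg, Complex.norm_real, Real.norm_eq_abs, abs_of_pos hd]
    linarith

/-- The circle `‖w‖⁴ = 1 - t` lies in the closure of `Ω(t)`, so a component starting inside it
cannot cross it. -/
theorem innerRegion_subset_hole {t : ℝ} (ht : 0 ≤ t) : innerRegion t ⊆ hole t := by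
  rintro z ⟨hz1, hz2⟩
  have hzc : z ∈ (closure (Omega t))ᶜ := fun hc => absurd (closure_Omega_subset t hc) (not_le.2 hz2)
  refine ⟨hzc, ?_⟩
  refine (Metric.isBounded_closedBall (x := (0 : ℂ)) (r := 1)).subset fun w hw => ?_
  rw [mem_closedBall_zero_iff]
  by_contra! hw1
  have hw4 : 1 - t ≤ ‖w‖ ^ 4 := by
    have := one_le_pow₀ hw1.le (n := 4)
    linarith
  obtain ⟨v, hv, hv4⟩ := isPreconnected_connectedComponentIn.intermediate_value
    (f := fun z : ℂ => ‖z‖ ^ 4) (mem_connectedComponentIn hzc) hw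
    (by fun_prop) ⟨hz1.le, hw4⟩
  exact connectedComponentIn_subset _ _ hv (mem_closure_Omega_of_norm_pow_four_eq ht hv4)

/-- The outward ray from `z` never meets the closure of `Ω(t)`: with `M = ‖z‖⁴`, for `s ≥ 1`, `Q (s
z) - t` exceeds `(s² - 1)(s² M - (1 - t)) ≥ 0`. -/
theorem notMem_hole {t : ℝ} {z : ℂ} (hz1 : 1 - t ≤ ‖z‖ ^ 4) (hz2 : t < Q z) :
    z ∉ hole t := by
  rintro ⟨-, hb⟩
  have hz0 : z ≠ 0 := by
    rintro rfl
    norm_num [Q_eq] at hz1 hz2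
    linarith
  have hsub : (fun s : ℝ => (s : ℂ) * z) '' Set.Ici 1 ⊆
      connectedComponentIn (closure (Omega t))ᶜ z := by
    refine IsPreconnected.subset_connectedComponentIn
      (isPreconnected_Ici.image _ (by fun_prop)) ⟨1, by simp, by simp⟩ ?_
    rintro _ ⟨s, hs, rfl⟩ hc
    have hQ := closure_Omega_subset t hc
    rw [norm_pow_four_eq] at hz1
    rw [Q_eq] at hz2
    simp only [Set.mem_ofPred_eq, Q_eq, Complex.re_ofReal_mul, Complex.im_ofReal_mul] at hQ
    set A := 3 * z.re ^ 2 + z.im ^ 2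
    set M := (z.re ^ 2 + z.im ^ 2) ^ 2
    have hs1 : 1 ≤ s ^ 2 := one_le_pow₀ hs
    have e : ((s * z.re) ^ 2 + (s * z.im) ^ 2) ^ 2 -
        2 * (3 * (s * z.re) ^ 2 + (s * z.im) ^ 2) + 1 = (s ^ 2) ^ 2 * M - 2 * s ^ 2 * A + 1 := by
      ring
    rw [e] at hQ
    nlinarith [mul_nonneg (sub_nonneg.2 hs1) (sub_nonneg.2 hz1), sq_nonneg (s ^ 2 - 1),
      mul_nonneg (sub_nonneg.2 hs1) (sub_nonneg.2 hz2.le),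
      mul_nonneg (sq_nonneg (s ^ 2 - 1)) (sq_nonneg (z.re ^ 2 + z.im ^ 2))]
  obtain ⟨C, hC⟩ := (hb.subset hsub).exists_norm_le
  have hzn : 0 < ‖z‖ := norm_pos_iff.2 hz0
  have hCz := hC _ ⟨max 1 ((C + 1) / ‖z‖), Set.mem_Ici.2 (le_max_left _ _), rfl⟩
  rw [norm_mul, Complex.norm_real, Real.norm_eq_abs,
    abs_of_pos (lt_of_lt_of_le one_pos (le_max_left _ _))] at hCz
  have : (C + 1) / ‖z‖ * ‖z‖ ≤ max 1 ((C + 1) / ‖z‖) * ‖z‖ := by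
    gcongr; exact le_max_right _ _
  rw [div_mul_cancel₀ _ hzn.ne'] at this
  linarith

theorem g_eq_indicator_add_indicator {t : ℝ} (ht : 0 ≤ t) {z : ℂ} (hz : Q z ≠ t) :
    g t z = (outerRegion t).indicator 1 z + (innerRegion t).indicator 1 z := by
  classical
  unfold g
  by_cases hQ : Q z < t
  · have h1 : z ∈ outerRegion t := Or.inr hQ
    have h2 : z ∉ innerRegion t := fun h => lt_asymm hQ h.2
    have h3 : z ∈ Omega t := hQ
    simp [h1, h2, h3]
  have hQ' : t < Q z := lt_of_le_of_ne (not_lt.1 hQ) hz.symm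
  have h3 : z ∉ Omega t := hQ
  by_cases h4 : ‖z‖ ^ 4 < 1 - t
  · have h1 : z ∈ outerRegion t := Or.inl h4
    have h2 : z ∈ innerRegion t := ⟨h4, hQ'⟩
    simp [h1, h2, h3, innerRegion_subset_hole ht h2]
    norm_num
  · have h1 : z ∉ outerRegion t := fun h => h.elim h4 hQ
    have h2 : z ∉ innerRegion t := fun h => h4 h.1
    simp [h1, h2, h3, notMem_hole (not_lt.1 h4) hQ']

/-- Each vertical section is the root set of a monic quartic in `y`, hence finite. -/
theorem volume_Q_eq (t : ℝ) : volume {z | Q z = t} = 0 := by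
  have hms : MeasurableSet {z | Q z = t} :=
    (isClosed_eq continuous_Q continuous_const).measurableSet
  have hmp := Complex.volume_preserving_equiv_real_prod.symm
  rw [← hmp.measure_preimage hms.nullMeasurableSet]
  rw [Measure.volume_eq_prod, Measure.measure_prod_null (hmp.measurable hms)]
  refine ae_of_all _ fun x => ?_
  refine Set.Finite.measure_zero (?_ : Set.Finite _) _
  open Polynomial in
  have hp : (X ^ 4 + C (2 * x ^ 2 - 2) * X ^ 2 + C (x ^ 4 - 6 * x ^ 2 + 1 - t) : ℝ[X]) ≠ 0 := by
    have : (X ^ 4 + C (2 * x ^ 2 - 2) * X ^ 2 + C (x ^ 4 - 6 * x ^ 2 + 1 - t) : ℝ[X]).Monic := by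
      monicity!
    exact this.ne_zero
  refine (Polynomial.finite_setOfPred_isRoot hp).subset fun y hy => ?_
  have hy' : Q (Complex.measurableEquivRealProd.symm (x, y)) = t := hy
  rw [Q_eq] at hy'
  simp only [Complex.measurableEquivRealProd_symm_apply] at hy'
  simp only [Set.mem_ofPred_eq, Polynomial.IsRoot.def, Polynomial.eval_add, Polynomial.eval_mul,
    Polynomial.eval_pow, Polynomial.eval_X, Polynomial.eval_C]
  linarith

theorem ae_Q_ne (t : ℝ) : ∀ᵐ z : ℂ, Q z ≠ t := by
  simpa [ae_iff] using volume_Q_eq t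

/-- `g t` is nonzero almost everywhere on this open region, hence on a dense part of it. Harmonicity
near the support thus covers the star-shaped compact set. -/
theorem closure_outerRegion_subset_tsupport {t : ℝ} (ht : 0 ≤ t) :
    closure (outerRegion t) ⊆ tsupport (g t) := by
  refine closure_minimal ?_ isClosed_closure
  refine ((Measure.dense_of_ae (ae_Q_ne t)).open_subset_closure_inter
    (isOpen_outerRegion t)).trans (closure_mono ?_)
  rintro z ⟨hz, hQ⟩
  rw [Function.mem_support, g_eq_indicator_add_indicator ht hQ]
  have : 0 ≤ (innerRegion t).indicator (1 : ℂ → ℝ) z := Set.indicator_nonneg (by simp) z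
  rw [Set.indicator_of_mem hz]
  simp only [Pi.one_apply]
  positivity

theorem norm_le_of_mem_outerRegion {t : ℝ} (ht0 : 0 ≤ t) (ht1 : t ≤ 1) {z : ℂ}
    (hz : z ∈ outerRegion t) : ‖z‖ ≤ 3 := by
  have h2 := norm_sq_eq z
  have : ‖z‖ ^ 2 ≤ 9 := by
    rcases hz with hz | hz
    · rw [norm_pow_four_eq] at hz
      nlinarith [sq_nonneg z.re, sq_nonneg z.im]
    · rw [Q_eq] at hz
      nlinarith [sq_nonneg z.re, sq_nonneg z.im]
  nlinarith [norm_nonneg z]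

theorem isCompact_closure_outerRegion {t : ℝ} (ht0 : 0 ≤ t) (ht1 : t ≤ 1) :
    IsCompact (closure (outerRegion t)) :=
  (Metric.isBounded_closedBall (x := (0 : ℂ)) (r := 3)).subset
    (fun _ hz => mem_closedBall_zero_iff.2 (norm_le_of_mem_outerRegion ht0 ht1 hz))
    |>.isCompact_closure

/-- If `s z` leaves the disk `‖w‖⁴ < 1 - t`, then `Q z < t` and, with `M = ‖z‖⁴`, `Q (s z) - t < (s²
- 1)(s² M - (1 - t)) ≤ 0`. -/
theorem mul_mem_outerRegion {t s : ℝ} (hs0 : 0 < s) (hs1 : s ≤ 1) {z : ℂ}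
    (hz : z ∈ outerRegion t) : (s : ℂ) * z ∈ outerRegion t := by
  by_cases hsz : ‖(s : ℂ) * z‖ ^ 4 < 1 - t
  · exact Or.inl hsz
  refine Or.inr ?_
  rw [not_lt, norm_mul, Complex.norm_real, mul_pow, Real.norm_eq_abs, abs_of_pos hs0] at hsz
  have hs4 : s ^ 4 ≤ s ^ 2 := pow_le_pow_of_le_one hs0.le hs1 (by norm_num)
  have hs2 : s ^ 2 ≤ 1 := pow_le_one₀ hs0.le hs1
  have hQ : Q z < t := by
    refine hz.resolve_left fun h => ?_
    have : s ^ 4 * ‖z‖ ^ 4 ≤ ‖z‖ ^ 4 :=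
      mul_le_of_le_one_left (by positivity) (pow_le_one₀ hs0.le hs1)
    linarith
  rw [Q_eq] at hQ ⊢
  rw [norm_pow_four_eq] at hsz
  simp only [Complex.re_ofReal_mul, Complex.im_ofReal_mul]
  set A := 3 * z.re ^ 2 + z.im ^ 2
  set M := (z.re ^ 2 + z.im ^ 2) ^ 2
  have hM : 0 ≤ M := sq_nonneg _
  have e : ((s * z.re) ^ 2 + (s * z.im) ^ 2) ^ 2 -
      2 * (3 * (s * z.re) ^ 2 + (s * z.im) ^ 2) + 1 = s ^ 4 * M - s ^ 2 * (2 * A) + 1 := by ring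
  rw [e]
  have h1 : 1 - t ≤ s ^ 2 * M := hsz.trans (mul_le_mul_of_nonneg_right hs4 hM)
  have h2 : 0 < s ^ 2 * (2 * A - (M + 1 - t)) := mul_pos (by positivity) (by linarith)
  nlinarith [mul_nonneg (sub_nonneg.2 h1) (sub_nonneg.2 hs2)]

theorem mul_mem_closure_outerRegion {t : ℝ} {s : ℝ} (hs : s ∈ Set.Icc (0 : ℝ) 1) {z : ℂ}
    (hz : z ∈ closure (outerRegion t)) : (s : ℂ) * z ∈ closure (outerRegion t) := by
  -- The value `s = 0` is reached only in the limit: for `t = 1` the origin is not in the open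
  -- region.
  rw [← closure_Ioc zero_ne_one] at hs
  exact map_mem_closure₂ (f := fun (s : ℝ) (z : ℂ) => (s : ℂ) * z) (by fun_prop) hs hz
    fun a ha b hb => mul_mem_outerRegion ha.1 ha.2 hb

theorem one_mem_outerRegion {t : ℝ} (ht : 0 ≤ t) : (1 : ℂ) ∈ outerRegion t := by
  refine Or.inr ?_
  norm_num [Q_eq]
  linarith

theorem neg_mem_outerRegion {t : ℝ} {z : ℂ} : -z ∈ outerRegion t ↔ z ∈ outerRegion t := by
  simp [outerRegion, Q_eq]

theorem neg_mem_innerRegion {t : ℝ} {z : ℂ} : -z ∈ innerRegion t ↔ z ∈ innerRegion t := by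
  simp [innerRegion, Q_eq]

theorem innerRegion_subset_outerRegion (t : ℝ) : innerRegion t ⊆ outerRegion t :=
  fun _ hz => Or.inl hz.1

end LevelLine

/-! ### Moments of symmetric regions. -/

/-- A moment of even order of a planar region `r² < ρ(θ)` given in polar coordinates. -/
theorem setIntegral_pow_of_polar {S : Set ℂ} (hS : MeasurableSet S) {ρ : ℝ → ℝ}
    (hρ : Continuous ρ) (hρ0 : ∀ θ, 0 ≤ ρ θ)
    (hSρ : ∀ r θ : ℝ, 0 < r → (Complex.polarCoord.symm (r, θ) ∈ S ↔ r ^ 2 < ρ θ)) (m : ℕ) :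
    ∫ z in S, z ^ (2 * m) = (2 * m + 2 : ℂ)⁻¹ *
      ∫ θ in -Real.pi..Real.pi, Complex.exp (2 * m * θ * Complex.I) * (ρ θ : ℂ) ^ (m + 1) := by
  set f : ℝ × ℝ → ℂ := fun p =>
    (p.1 : ℂ) ^ (2 * m + 1) * Complex.exp (2 * m * p.2 * Complex.I) with hf
  have hfc : Continuous f := by fun_prop
  set A : Set (ℝ × ℝ) := {p | p.1 ^ 2 < ρ p.2} with hA
  have hAm : MeasurableSet A :=
    (isOpen_lt (by fun_prop : Continuous fun p : ℝ × ℝ => p.1 ^ 2)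
      (hρ.comp continuous_snd)).measurableSet
  have hπ : -Real.pi ≤ Real.pi := by linarith [Real.pi_pos]
  have hpolar : ∫ z in S, z ^ (2 * m) =
      ∫ p in Set.Ioi (0 : ℝ) ×ˢ Set.Ioo (-Real.pi) Real.pi, A.indicator f p := by
    rw [← integral_indicator hS, ← Complex.integral_comp_polarCoord_symm]
    change ∫ p in Set.Ioi (0 : ℝ) ×ˢ Set.Ioo (-Real.pi) Real.pi, _ = _
    refine setIntegral_congr_fun (measurableSet_Ioi.prod measurableSet_Ioo) fun p hp => ?_
    obtain ⟨r, θ⟩ := p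
    have hr : 0 < r := hp.1
    by_cases h : r ^ 2 < ρ θ
    · have h1 := (hSρ r θ hr).2 h
      have h2 : (r, θ) ∈ A := h
      simp only [Set.indicator_of_mem h1, Set.indicator_of_mem h2, hf]
      rw [Complex.polarCoord_symm_apply, Complex.ofReal_cos, Complex.ofReal_sin, ← Complex.exp_mul_I, mul_pow, ← Complex.exp_nat_mul,
        Complex.real_smul]
      push_cast
      ring_nf
    · have h1 := mt (hSρ r θ hr).1 h
      have h2 : (r, θ) ∉ A := h
      simp only [Set.indicator_of_notMem h1, Set.indicator_of_notMem h2, smul_zero]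
  obtain ⟨R, hR⟩ := (isCompact_Icc (a := -Real.pi) (b := Real.pi)).exists_bound_of_continuousOn
    hρ.continuousOn
  have hint : IntegrableOn (A.indicator f) (Set.Ioi (0 : ℝ) ×ˢ Set.Ioo (-Real.pi) Real.pi)
      (volume.prod volume) := by
    -- Since `r² < ρ θ ≤ R` implies `r ≤ R + 1`, the integrand lives on a compact box.
    have h1 : IntegrableOn (A.indicator f)
        (Set.Icc (0 : ℝ) (R + 1) ×ˢ Set.Icc (-Real.pi) Real.pi) (volume.prod volume) :=
      (hfc.continuousOn.integrableOn_compact (isCompact_Icc.prod isCompact_Icc)).indicator hAm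
    refine h1.of_forall_sdiff_eq_zero (measurableSet_Ioi.prod measurableSet_Ioo) ?_
    rintro ⟨r, θ⟩ ⟨⟨hr, hθ⟩, hn⟩
    refine Set.indicator_of_notMem (fun h => hn ?_) _
    have h' : r ^ 2 < ρ θ := h
    have hθ' := Set.Ioo_subset_Icc_self hθ
    have hr0 : 0 < r := hr
    have h2 := (le_abs_self _).trans (hR θ hθ')
    exact ⟨⟨hr0.le, by nlinarith⟩, hθ'⟩
  have hinner : ∀ θ, ∫ r in Set.Ioi (0 : ℝ), A.indicator f (r, θ) =
      (2 * m + 2 : ℂ)⁻¹ * (Complex.exp (2 * m * θ * Complex.I) * (ρ θ : ℂ) ^ (m + 1)) := by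
    intro θ
    have h1 : (fun r => A.indicator f (r, θ)) =
        {r : ℝ | r ^ 2 < ρ θ}.indicator fun r => f (r, θ) := rfl
    have hm' : MeasurableSet {r : ℝ | r ^ 2 < ρ θ} :=
      (isOpen_lt (continuous_pow 2) continuous_const).measurableSet
    have hset : Set.Ioi (0 : ℝ) ∩ {r : ℝ | r ^ 2 < ρ θ} = Set.Ioo 0 √(ρ θ) := by
      ext r
      constructor
      · rintro ⟨h1, h2⟩
        exact ⟨h1, Real.lt_sqrt_of_sq_lt h2⟩
      · rintro ⟨h1, h2⟩
        exact ⟨h1, (Real.lt_sqrt h1.le).1 h2⟩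
    rw [h1, setIntegral_indicator hm', hset, ← integral_Ioc_eq_integral_Ioo,
      ← intervalIntegral.integral_of_le (Real.sqrt_nonneg _)]
    simp only [hf]
    rw [intervalIntegral.integral_mul_const]
    have h2 : ∫ r in (0 : ℝ)..√(ρ θ), (r : ℂ) ^ (2 * m + 1) =
        (2 * m + 2 : ℂ)⁻¹ * (ρ θ : ℂ) ^ (m + 1) := by
      have h3 : ∀ r : ℝ, (r : ℂ) ^ (2 * m + 1) = ((r ^ (2 * m + 1) : ℝ) : ℂ) := by simp
      simp only [h3]
      rw [intervalIntegral.integral_ofReal, integral_pow]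
      have h4 : √(ρ θ) ^ (2 * m + 1 + 1) = ρ θ ^ (m + 1) := by
        rw [show 2 * m + 1 + 1 = 2 * (m + 1) by ring, pow_mul, Real.sq_sqrt (hρ0 θ)]
      rw [h4]
      push_cast
      simp only [ne_eq, Nat.succ_ne_zero, not_false_eq_true, zero_pow, sub_zero]
      rw [div_eq_inv_mul]
      ring_nf
    rw [h2]
    ring
  rw [hpolar, Measure.volume_eq_prod, ← Measure.prod_restrict, integral_prod_symm]
  · simp only [hinner]
    rw [integral_const_mul, ← integral_Ioc_eq_integral_Ioo, intervalIntegral.integral_of_le hπ]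
  · rw [Measure.prod_restrict]
    exact hint

theorem setIntegral_odd_pow_eq_zero {S : Set ℂ} (hS : MeasurableSet S) (hneg : ∀ z, -z ∈ S ↔ z ∈ S)
    {n : ℕ} (hn : Odd n) : ∫ z in S, z ^ n = 0 := by
  rw [← integral_indicator hS]
  have h := integral_neg_eq_self (S.indicator fun z : ℂ => z ^ n) volume
  have h' : (fun z : ℂ => S.indicator (fun z => z ^ n) (-z)) =
      fun z => -S.indicator (fun z => z ^ n) z := by
    ext z
    by_cases hz : z ∈ S
    · simp [hz, hneg, hn.neg_pow]
    · simp [hz, hneg]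
  rw [h', integral_neg] at h
  exact CharZero.neg_eq_self_iff.1 h

/-! ### Polar radii and Fourier coefficients of their power sums. -/

namespace LevelLine

/-- The square of the polar radius of the outer boundary curve of `Ω(t)`. -/
noncomputable def outerRadiusSq (t θ : ℝ) : ℝ :=
  2 + Real.cos (2 * θ) + √((2 + Real.cos (2 * θ)) ^ 2 - 1 + t)

/-- The square of the polar radius of the inner boundary curve of `Ω(t)`. -/
noncomputable def innerRadiusSq (t θ : ℝ) : ℝ :=
  2 + Real.cos (2 * θ) - √((2 + Real.cos (2 * θ)) ^ 2 - 1 + t)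

theorem continuous_outerRadiusSq (t : ℝ) : Continuous (outerRadiusSq t) := by
  unfold outerRadiusSq; fun_prop

theorem continuous_innerRadiusSq (t : ℝ) : Continuous (innerRadiusSq t) := by
  unfold innerRadiusSq; fun_prop

theorem outerRadiusSq_add_innerRadiusSq (t θ : ℝ) :
    outerRadiusSq t θ + innerRadiusSq t θ = 2 * (2 + Real.cos (2 * θ)) := by
  unfold outerRadiusSq innerRadiusSq; ring

theorem outerRadiusSq_mul_innerRadiusSq {t : ℝ} (ht : 0 ≤ t) (θ : ℝ) :
    outerRadiusSq t θ * innerRadiusSq t θ = 1 - t := by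
  have h : 0 ≤ (2 + Real.cos (2 * θ)) ^ 2 - 1 + t := by
    nlinarith [Real.neg_one_le_cos (2 * θ)]
  have := Real.sq_sqrt h
  unfold outerRadiusSq innerRadiusSq
  linear_combination -this

theorem innerRadiusSq_le_outerRadiusSq (t θ : ℝ) : innerRadiusSq t θ ≤ outerRadiusSq t θ := by
  unfold outerRadiusSq innerRadiusSq
  linarith [Real.sqrt_nonneg ((2 + Real.cos (2 * θ)) ^ 2 - 1 + t)]

theorem outerRadiusSq_pos (t θ : ℝ) : 0 < outerRadiusSq t θ := by
  unfold outerRadiusSq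
  linarith [Real.sqrt_nonneg ((2 + Real.cos (2 * θ)) ^ 2 - 1 + t), Real.neg_one_le_cos (2 * θ)]

theorem innerRadiusSq_nonneg {t : ℝ} (ht0 : 0 ≤ t) (ht1 : t ≤ 1) (θ : ℝ) :
    0 ≤ innerRadiusSq t θ := by
  refine nonneg_of_mul_nonneg_right ?_ (outerRadiusSq_pos t θ)
  rw [outerRadiusSq_mul_innerRadiusSq ht0]
  linarith

theorem Q_polarCoord_symm {t : ℝ} (ht : 0 ≤ t) (r θ : ℝ) :
    Q (Complex.polarCoord.symm (r, θ)) - t =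
      (r ^ 2 - outerRadiusSq t θ) * (r ^ 2 - innerRadiusSq t θ) := by
  have h1 := outerRadiusSq_add_innerRadiusSq t θ
  have h2 := outerRadiusSq_mul_innerRadiusSq ht θ
  have e1 : (Complex.polarCoord.symm (r, θ)).re = r * Real.cos θ := by
    simp [Complex.polarCoord_symm_apply, Complex.cos_ofReal_re]
  have e2 : (Complex.polarCoord.symm (r, θ)).im = r * Real.sin θ := by
    simp [Complex.polarCoord_symm_apply, Complex.sin_ofReal_re]
  rw [Real.cos_two_mul] at h1
  rw [Q_eq, e1, e2, mul_pow, mul_pow, Real.sin_sq]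
  linear_combination r ^ 2 * h1 - h2

theorem norm_polarCoord_symm_pow_four (r θ : ℝ) :
    ‖Complex.polarCoord.symm (r, θ)‖ ^ 4 = (r ^ 2) ^ 2 := by
  rw [Complex.norm_polarCoord_symm, ← pow_mul, Even.pow_abs (by decide)]

theorem polarCoord_symm_mem_outerRegion {t : ℝ} (ht0 : 0 ≤ t) (ht1 : t ≤ 1) (r θ : ℝ)
    (hr : 0 < r) : Complex.polarCoord.symm (r, θ) ∈ outerRegion t ↔ r ^ 2 < outerRadiusSq t θ := by
  have h1 := Q_polarCoord_symm ht0 r θ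
  have h2 := outerRadiusSq_mul_innerRadiusSq ht0 θ
  have h3 := innerRadiusSq_le_outerRadiusSq t θ
  have h4 := outerRadiusSq_pos t θ
  have h5 := innerRadiusSq_nonneg ht0 ht1 θ
  have hr2 : 0 < r ^ 2 := by positivity
  change ‖_‖ ^ 4 < 1 - t ∨ Q _ < t ↔ _
  rw [norm_polarCoord_symm_pow_four, ← h2, ← sub_neg (a := Q _), h1]
  constructor
  · intro h
    by_contra! hlt
    rcases h with h | h
    · nlinarith
    · exact absurd h (not_lt.2 (mul_nonneg (by linarith) (by linarith)))
  · intro h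
    rcases le_or_gt (r ^ 2) (innerRadiusSq t θ) with hi | hi
    · left; nlinarith
    · right
      exact mul_neg_of_neg_of_pos (by linarith) (by linarith)

theorem polarCoord_symm_mem_innerRegion {t : ℝ} (ht0 : 0 ≤ t) (ht1 : t ≤ 1) (r θ : ℝ)
    (hr : 0 < r) : Complex.polarCoord.symm (r, θ) ∈ innerRegion t ↔ r ^ 2 < innerRadiusSq t θ := by
  have h1 := Q_polarCoord_symm ht0 r θ
  have h2 := outerRadiusSq_mul_innerRadiusSq ht0 θ
  have h3 := innerRadiusSq_le_outerRadiusSq t θ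
  have h4 := outerRadiusSq_pos t θ
  have h5 := innerRadiusSq_nonneg ht0 ht1 θ
  have hr2 : 0 < r ^ 2 := by positivity
  change ‖_‖ ^ 4 < 1 - t ∧ t < Q _ ↔ _
  rw [norm_polarCoord_symm_pow_four, ← h2, ← sub_pos (a := Q _), h1]
  constructor
  · rintro ⟨h, h'⟩
    by_contra! hlt
    rcases le_or_gt (r ^ 2) (outerRadiusSq t θ) with hi | hi
    · exact absurd h' (not_lt.2 (mul_nonpos_of_nonpos_of_nonneg (by linarith) (by linarith)))
    · nlinarith
  · intro h
    exact ⟨by nlinarith, mul_pos_of_neg_of_neg (by linarith) (by linarith)⟩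

open Complex

theorem integral_exp_two_mul_int (j : ℤ) :
    ∫ θ in -Real.pi..Real.pi, exp (2 * j * θ * I) = if j = 0 then 2 * (Real.pi : ℂ) else 0 := by
  split_ifs with hj
  · simp [hj]; ring
  · have h : ∀ θ : ℝ, exp (2 * j * θ * I) = exp (2 * j * I * θ) := fun θ => by ring_nf
    simp only [h]
    rw [integral_exp_mul_complex (by simp [hj])]
    have h1 : exp (2 * j * I * (Real.pi : ℝ)) = 1 := by
      rw [← exp_int_mul_two_pi_mul_I j]; ring_nf
    have h2 : exp (2 * j * I * (-Real.pi : ℝ)) = 1 := by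
      rw [← exp_int_mul_two_pi_mul_I (-j)]; push_cast; ring_nf
    rw [h1, h2]; simp

/-- Fourier coefficients of the power sums of the squared polar radii. -/
noncomputable def powerSumCoeff (t : ℝ) (k : ℕ) (j : ℤ) : ℂ :=
  ∫ θ in -Real.pi..Real.pi,
    exp (2 * j * θ * I) * ((outerRadiusSq t θ : ℂ) ^ k + (innerRadiusSq t θ : ℂ) ^ k)

theorem intervalIntegrable_powerSum (t : ℝ) (k : ℕ) (j : ℤ) :
    IntervalIntegrable (fun θ : ℝ =>
      exp (2 * j * θ * I) * ((outerRadiusSq t θ : ℂ) ^ k + (innerRadiusSq t θ : ℂ) ^ k))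
      volume (-Real.pi) Real.pi := by
  have := continuous_outerRadiusSq t
  have := continuous_innerRadiusSq t
  exact Continuous.intervalIntegrable (by fun_prop) _ _

theorem exp_mul_two_cos (j : ℤ) (θ : ℝ) :
    exp (2 * j * θ * I) * ((2 * (2 + Real.cos (2 * θ)) : ℝ) : ℂ) =
      4 * exp (2 * j * θ * I) + exp (2 * (j + 1 : ℤ) * θ * I) + exp (2 * (j - 1 : ℤ) * θ * I) := by
  have h1 : exp (2 * (j + 1 : ℤ) * θ * I) = exp (2 * j * θ * I) * exp (2 * θ * I) := by
    rw [← exp_add]; push_cast; ring_nf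
  have h2 : exp (2 * (j - 1 : ℤ) * θ * I) = exp (2 * j * θ * I) * exp (-(2 * θ) * I) := by
    rw [← exp_add]; push_cast; ring_nf
  have h3 := two_cos (2 * θ : ℂ)
  rw [h1, h2]
  push_cast
  linear_combination exp (2 * j * θ * I) * h3

theorem powerSumCoeff_zero (t : ℝ) (j : ℤ) :
    powerSumCoeff t 0 j = if j = 0 then 4 * (Real.pi : ℂ) else 0 := by
  unfold powerSumCoeff
  simp only [pow_zero]
  rw [intervalIntegral.integral_mul_const, integral_exp_two_mul_int]
  split_ifs <;> ring

theorem powerSumCoeff_one (t : ℝ) (j : ℤ) :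
    powerSumCoeff t 1 j = 4 * (if j = 0 then 2 * (Real.pi : ℂ) else 0) +
      (if j + 1 = 0 then 2 * (Real.pi : ℂ) else 0) +
      if j - 1 = 0 then 2 * (Real.pi : ℂ) else 0 := by
  have hi : ∀ j : ℤ, IntervalIntegrable (fun θ : ℝ => exp (2 * j * θ * I)) volume
      (-Real.pi) Real.pi := fun j => Continuous.intervalIntegrable (by fun_prop) _ _
  have h : ∀ θ : ℝ, exp (2 * j * θ * I) *
      ((outerRadiusSq t θ : ℂ) ^ 1 + (innerRadiusSq t θ : ℂ) ^ 1) =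
      4 * exp (2 * j * θ * I) + exp (2 * (j + 1 : ℤ) * θ * I) + exp (2 * (j - 1 : ℤ) * θ * I) := by
    intro θ
    rw [← exp_mul_two_cos, pow_one, pow_one, ← outerRadiusSq_add_innerRadiusSq t]
    push_cast; rfl
  unfold powerSumCoeff
  simp only [h]
  rw [intervalIntegral.integral_add (((hi j).const_mul 4).add (hi _)) (hi _),
    intervalIntegral.integral_add ((hi j).const_mul 4) (hi _),
    intervalIntegral.integral_const_mul]
  simp only [integral_exp_two_mul_int]

/-- Newton's recurrence for the two roots: multiplying by their sum `4 + exp(2iθ) + exp(-2iθ)`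
shifts Fourier indices, and their product is the constant `1 - t`. -/
theorem powerSumCoeff_add_two {t : ℝ} (ht : 0 ≤ t) (k : ℕ) (j : ℤ) :
    powerSumCoeff t (k + 2) j = 4 * powerSumCoeff t (k + 1) j + powerSumCoeff t (k + 1) (j + 1) +
      powerSumCoeff t (k + 1) (j - 1) - (1 - t) * powerSumCoeff t k j := by
  have hi := intervalIntegrable_powerSum t
  unfold powerSumCoeff
  rw [← intervalIntegral.integral_const_mul, ← intervalIntegral.integral_const_mul,
    ← intervalIntegral.integral_add ((hi _ _).const_mul 4) (hi _ _),
    ← intervalIntegral.integral_add (((hi _ _).const_mul 4).add (hi _ _)) (hi _ _),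
    ← intervalIntegral.integral_sub ((((hi _ _).const_mul 4).add (hi _ _)).add (hi _ _))
      ((hi _ _).const_mul _)]
  refine intervalIntegral.integral_congr fun θ _ => ?_
  have h1 := exp_mul_two_cos j θ
  rw [← outerRadiusSq_add_innerRadiusSq t] at h1
  have h2 : (outerRadiusSq t θ : ℂ) * innerRadiusSq t θ = 1 - t := by
    exact_mod_cast congrArg (fun x : ℝ => (x : ℂ)) (outerRadiusSq_mul_innerRadiusSq ht θ)
  simp only [ofReal_add] at h1
  linear_combination ((outerRadiusSq t θ : ℂ) ^ (k + 1) + (innerRadiusSq t θ : ℂ) ^ (k + 1)) * h1 -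
    exp (2 * j * θ * I) * ((outerRadiusSq t θ : ℂ) ^ k + (innerRadiusSq t θ : ℂ) ^ k) * h2

/-- The term with `1 - t` has degree two below the top, so the two leading coefficients ignore it.
The second one gains four times the first at each step. The exponent starts at `k + 1` because the
zeroth power sum is `2`, with leading coefficient `4π`. -/
theorem powerSumCoeff_values {t : ℝ} (ht : 0 ≤ t) (k : ℕ) :
    (∀ j : ℤ, k < j → powerSumCoeff t k j = 0) ∧
    (∀ j : ℤ, k + 1 < j → powerSumCoeff t (k + 1) j = 0) ∧
    powerSumCoeff t (k + 1) (k + 1) = 2 * Real.pi ∧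
    powerSumCoeff t (k + 1) k = 2 * Real.pi * (4 * (k + 1)) := by
  induction k with
  | zero =>
    refine ⟨fun j hj => ?_, fun j hj => ?_, ?_, ?_⟩
    · rw [powerSumCoeff_zero, if_neg (by lia)]
    · rw [zero_add, powerSumCoeff_one, if_neg (by lia), if_neg (by lia), if_neg (by lia)]
      simp
    · rw [zero_add, powerSumCoeff_one]; simp
    · rw [zero_add, powerSumCoeff_one]; simp; ring
  | succ k ih =>
    obtain ⟨h1, h2, h3, h4⟩ := ih
    push_cast
    refine ⟨h2, fun j hj => ?_, ?_, ?_⟩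
    · rw [powerSumCoeff_add_two ht, h2 j (by lia), h2 _ (by lia), h2 _ (by lia), h1 j (by lia)]
      simp
    · rw [powerSumCoeff_add_two ht, h2 _ (by lia), h2 _ (by lia), add_sub_cancel_right, h3,
        h1 _ (by lia)]
      simp
    · rw [powerSumCoeff_add_two ht, h3, h2 _ (by lia), add_sub_cancel_right, h4, h1 _ (by lia)]
      ring

theorem moments_eq {t : ℝ} (ht0 : 0 ≤ t) (ht1 : t ≤ 1) (n : ℕ) :
    (∫ z in outerRegion t, z ^ n) + ∫ z in innerRegion t, z ^ n =
      2 * Real.pi * ((-1 : ℂ) ^ n + 1 ^ n) := by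
  have hmo := (isOpen_outerRegion t).measurableSet
  have hmi := (isOpen_innerRegion t).measurableSet
  rcases Nat.even_or_odd' n with ⟨m, rfl | rfl⟩
  · rw [setIntegral_pow_of_polar hmo (continuous_outerRadiusSq t)
        (fun θ => (outerRadiusSq_pos t θ).le) (polarCoord_symm_mem_outerRegion ht0 ht1),
      setIntegral_pow_of_polar hmi (continuous_innerRadiusSq t)
        (innerRadiusSq_nonneg ht0 ht1) (polarCoord_symm_mem_innerRegion ht0 ht1),
      ← mul_add, ← intervalIntegral.integral_add]
    -- The coefficient `2π · 4(m + 1)`, divided by `2m + 2`, is `4π`.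
    · have h := (powerSumCoeff_values ht0 m).2.2.2
      unfold powerSumCoeff at h
      push_cast at h
      simp only [← mul_add]
      rw [h]
      have : (2 * m + 2 : ℂ) ≠ 0 := by
        have : ((2 * m + 2 : ℕ) : ℂ) ≠ 0 := Nat.cast_ne_zero.2 (by lia)
        exact_mod_cast this
      simp only [pow_mul]
      field_simp
      norm_num
    all_goals
      have := continuous_outerRadiusSq t
      have := continuous_innerRadiusSq t
      exact Continuous.intervalIntegrable (by fun_prop) _ _
  · rw [setIntegral_odd_pow_eq_zero hmo (fun _ => neg_mem_outerRegion) (odd_two_mul_add_one m),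
      setIntegral_odd_pow_eq_zero hmi (fun _ => neg_mem_innerRegion) (odd_two_mul_add_one m),
      (odd_two_mul_add_one m).neg_one_pow]
    simp

end LevelLine

/-! ### Complex-valued test functions and conclusion. -/

open Set in
/-- Complex-valued version of `setIntegral_eq_of_moments_of_harmonicOnNhd`. -/
theorem setIntegral_eq_of_moments_of_harmonicOnNhd_complex {K : Set ℂ} (hK : IsCompact K)
    (h0 : 0 ∈ K) (hstar : ∀ s ∈ Icc (0 : ℝ) 1, ∀ z ∈ K, (s : ℂ) * z ∈ K) {μ ν : Measure ℂ}
    [IsFiniteMeasure μ] [IsFiniteMeasure ν]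
    (hm : ∀ n : ℕ, ∫ z in K, z ^ n ∂μ = ∫ z in K, z ^ n ∂ν) {h : ℂ → ℂ}
    (hh : HarmonicOnNhd h K) : ∫ z in K, h z ∂μ = ∫ z in K, h z ∂ν := by
  have hint : ∀ (ρ : Measure ℂ) [IsFiniteMeasure ρ], Integrable h (ρ.restrict K) := fun ρ _ =>
    hh.continuousOn.integrableOn_compact hK
  have hre := setIntegral_eq_of_moments_of_harmonicOnNhd hK h0 hstar hm
    (hh.comp_CLM Complex.reCLM)
  have him := setIntegral_eq_of_moments_of_harmonicOnNhd hK h0 hstar hm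
    (hh.comp_CLM Complex.imCLM)
  refine Complex.ext ?_ ?_
  · exact (integral_re (hint μ)).symm.trans (hre.trans (integral_re (hint ν)))
  · exact (integral_im (hint μ)).symm.trans (him.trans (integral_im (hint ν)))

namespace LevelLine

theorem setIntegral_outerRegion_add_innerRegion {t : ℝ} (ht0 : 0 ≤ t) (ht1 : t ≤ 1) {h : ℂ → ℂ}
    (hh : HarmonicOnNhd h (closure (outerRegion t))) :
    (∫ z in outerRegion t, h z) + ∫ z in innerRegion t, h z = 2 * Real.pi * (h (-1) + h 1) := by
  set K := closure (outerRegion t) with hKdef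
  have hK : IsCompact K := isCompact_closure_outerRegion ht0 ht1
  have h1 : (1 : ℂ) ∈ outerRegion t := one_mem_outerRegion ht0
  have hoK : outerRegion t ⊆ K := subset_closure
  have hiK : innerRegion t ⊆ K := (innerRegion_subset_outerRegion t).trans hoK
  have h1K : (1 : ℂ) ∈ K := hoK h1
  have hn1K : (-1 : ℂ) ∈ K := hoK (neg_mem_outerRegion.2 h1)
  have h0K : (0 : ℂ) ∈ K := by
    simpa using mul_mem_closure_outerRegion (t := t) (s := 0) ⟨le_rfl, zero_le_one⟩ h1K
  have hKfin : volume K < ⊤ := hK.measure_lt_top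
  have : IsFiniteMeasure (volume.restrict (outerRegion t)) :=
    isFiniteMeasure_restrict.2 ((measure_mono hoK).trans_lt hKfin).ne
  have : IsFiniteMeasure (volume.restrict (innerRegion t)) :=
    isFiniteMeasure_restrict.2 ((measure_mono hiK).trans_lt hKfin).ne
  set μ : Measure ℂ := volume.restrict (outerRegion t) + volume.restrict (innerRegion t) with hμ
  set ν : Measure ℂ := (2 * Real.pi).toNNReal • (Measure.dirac (-1) + Measure.dirac 1) with hν
  have hμi : ∀ f : ℂ → ℂ, ContinuousOn f K →
      ∫ z in K, f z ∂μ = (∫ z in outerRegion t, f z) + ∫ z in innerRegion t, f z := by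
    intro f hf
    have hfi := hf.integrableOn_compact (μ := volume) hK
    rw [hμ, Measure.restrict_add, Measure.restrict_restrict hK.measurableSet,
      Measure.restrict_restrict hK.measurableSet, Set.inter_eq_right.2 hoK,
      Set.inter_eq_right.2 hiK]
    exact integral_add_measure (hfi.mono_set hoK) (hfi.mono_set hiK)
  have hνi : ∀ f : ℂ → ℂ, ∫ z in K, f z ∂ν = 2 * Real.pi * (f (-1) + f 1) := by
    intro f
    classical
    rw [hν, Measure.restrict_smul, Measure.restrict_add, restrict_dirac, restrict_dirac,
      if_pos h1K, if_pos hn1K, integral_smul_nnreal_measure,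
      integral_add_measure (integrable_dirac (by simp)) (integrable_dirac (by simp)),
      integral_dirac, integral_dirac, NNReal.smul_def, Complex.real_smul,
      Real.coe_toNNReal _ (by positivity)]
    push_cast
    rfl
  have key := setIntegral_eq_of_moments_of_harmonicOnNhd_complex (μ := μ) (ν := ν) hK h0K
    (fun s hs z hz => mul_mem_closure_outerRegion hs hz)
    (fun n => by rw [hμi _ (by fun_prop), hνi, moments_eq ht0 ht1]) hh
  rwa [hμi _ hh.continuousOn, hνi] at key

theorem mul_g_ae_eq {t : ℝ} (ht : 0 ≤ t) (h : ℂ → ℂ) :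
    (fun z => h z * (g t z : ℂ)) =ᵐ[volume]
      fun z => (outerRegion t).indicator h z + (innerRegion t).indicator h z := by
  filter_upwards [ae_Q_ne t] with z hz
  rw [g_eq_indicator_add_indicator ht hz]
  by_cases h1 : z ∈ outerRegion t <;> by_cases h2 : z ∈ innerRegion t <;> simp [h1, h2, mul_add]

end LevelLine

open LevelLine in
theorem proposition7p1 (t : ℝ) (ht0 : 0 ≤ t) (ht1 : t ≤ 1) (h : ℂ → ℂ)
    (hh : HarmonicOnNhd h (tsupport (LevelLine.g t))) :
    Integrable (fun z : ℂ => h z * (LevelLine.g t z : ℂ)) volume ∧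
      ∫ z : ℂ, h z * (LevelLine.g t z : ℂ) = 2 * (Real.pi : ℂ) * (h (-1) + h 1) := by
  have hK := hh.mono (closure_outerRegion_subset_tsupport ht0)
  have hmo := (isOpen_outerRegion t).measurableSet
  have hmi := (isOpen_innerRegion t).measurableSet
  have hi := hK.continuousOn.integrableOn_compact (μ := volume)
    (isCompact_closure_outerRegion ht0 ht1)
  have hio := (hi.mono_set subset_closure).integrable_indicator hmo
  have hii := (hi.mono_set ((innerRegion_subset_outerRegion t).trans
    subset_closure)).integrable_indicator hmi
  refine ⟨(integrable_congr (mul_g_ae_eq ht0 h)).2 (hio.add hii), ?_⟩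
  rw [integral_congr_ae (mul_g_ae_eq ht0 h), integral_add hio hii, integral_indicator hmo,
    integral_indicator hmi]
  exact setIntegral_outerRegion_add_innerRegion ht0 ht1 hK
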